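/- Let $X$ be a locally compact Hausdorff space and let $\sigma : \mathbb{Z} \curvearrowright X$ be a free action by homeomorphisms, i.e. $\sigma_n(x) = x$ for some $x \in X$ only if $n = 0$. Let $C_0(X) \rtimes_\sigma \mathbb{Z}$ be the (full) crossed product, i.e. the completion of the convolution $*$-algebra $C_c(\mathbb{Z}, C_0(X))$ in the norm $$\Big\| \sum_n f_n \delta_n \Big\| = \sup_{(\pi,u)} \Big\| \sum_n \pi(f_n) u^n \Big\|,$$ the supremum being over all pairs of a $*$-representation $\pi$ of $C_0(X)$ and a unitary $u$ on a common complex Hilbert space with $u\pi(f)u^* = \pi(f \circ \sigma_{-1})$ for all $f \in C_0(X)$. Write $f u^n$ for the image of $f\delta_n$ in it, and let $\gamma : \mathbb{T} \curvearrowright C_0(X) \rtimes_\sigma \mathbb{Z}$ be the gauge action, determined by $\gamma_z(f u^n) = z^n f u^n$ for $f \in C_0(X)$, $n \in \mathbb{Z}$, $z \in \mathbb{T}$. Then every tracial state $\tau$ on $C_0(X) \rtimes_\sigma \mathbb{Z}$ (a positive linear functional of norm one with $\tau(ab) = \tau(ba)$ for all $a, b$) is gauge invariant: $\tau(\gamma_z(a))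 = \tau(a)$ for all $z \in \mathbb{T}$ and $a \in C_0(X) \rtimes_\sigma \mathbb{Z}$. -/

import Mathlib

open scoped ZeroAtInfty ENNReal ComplexOrder

noncomputable section

namespace CrossedProductZ

universe u

section

variable (X : Type u) [TopologicalSpace X] [AddAction ℤ X] [ContinuousConstVAdd ℤ X]

/-- The homeomorphism `x ↦ n + x` of `X` given by `n : ℤ`, as a cocompact map. -/
def translation (n : ℤ) : CocompactMap X X where
  toFun x := n +ᵥ x
  continuous_toFun := continuous_const_vadd n
  cocompact_tendsto' := (Homeomorph.vadd n : X ≃ₜ X).isClosedEmbedding.tendsto_cocompact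

variable {X}

/-- The induced action of `ℤ` on `C₀(X)`: `(n · f)(x) = f ((-n) + x)`. -/
def act (n : ℤ) (f : C₀(X, ℂ)) : C₀(X, ℂ) := f.comp (translation X (-n))

@[simp]
theorem act_apply (n : ℤ) (f : C₀(X, ℂ)) (x : X) : act n f x = f ((-n) +ᵥ x) := rfl

variable (X)

/-- A covariant representation `(π, u)` of the dynamical system `(C₀(X), ℤ)` on a Hilbert space `H`:
a `*`-representation `π` of `C₀(X)` and a unitary `u` (equivalently the unitary representation
`n ↦ u ^ n` of `ℤ`) with `u π(f) u* = π(1 · f)`. -/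
structure CovariantRep : Type (u + 1) where
  H : Type u
  [normedAddCommGroup : NormedAddCommGroup H]
  [innerProductSpace : InnerProductSpace ℂ H]
  [completeSpace : CompleteSpace H]
  π : C₀(X, ℂ) →⋆ₙₐ[ℂ] (H →L[ℂ] H)
  u : unitary (H →L[ℂ] H)
  covariant : ∀ f : C₀(X, ℂ), (u : H →L[ℂ] H) * π f * star (u : H →L[ℂ] H) = π (act 1 f)

attribute [instance] CovariantRep.normedAddCommGroup CovariantRep.innerProductSpace
  CovariantRep.completeSpace

/-- The C*-algebra of bounded families of operators, one on each Hilbert space underlying a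
covariant representation, with the supremum norm. -/
def BoundedFamilies : Type (u + 1) :=
  lp (fun p : CovariantRep X => p.H →L[ℂ] p.H) ∞

instance : NonUnitalCStarAlgebra (BoundedFamilies X) :=
  inferInstanceAs (NonUnitalCStarAlgebra (lp (fun p : CovariantRep X => p.H →L[ℂ] p.H) ∞))

variable {X}

theorem norm_unitary_le {H : Type u} [NormedAddCommGroup H] [InnerProductSpace ℂ H]
    [CompleteSpace H] (v : unitary (H →L[ℂ] H)) : ‖(v : H →L[ℂ] H)‖ ≤ 1 := by
  have h : ‖star (v : H →L[ℂ] H) * (v : H →L[ℂ] H)‖ =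
      ‖(v : H →L[ℂ] H)‖ * ‖(v : H →L[ℂ] H)‖ := CStarRing.norm_star_mul_self
  rw [Unitary.coe_star_mul_self] at h
  have h1 : ‖(1 : H →L[ℂ] H)‖ ≤ 1 := ContinuousLinearMap.norm_id_le
  nlinarith [norm_nonneg (v : H →L[ℂ] H)]

/-- The monomial `f u ^ n` (that is, `f δ_n ∈ C_c(ℤ, C₀(X))`) in the universal representation: its
component at a covariant representation `(π, u)` is `π(f) u ^ n`. -/
def monomial (f : C₀(X, ℂ)) (n : ℤ) : BoundedFamilies X :=
  ⟨fun p => p.π f * ((p.u ^ n : unitary (p.H →L[ℂ] p.H)) : p.H →L[ℂ] p.H), by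
    refine memℓp_infty ⟨‖f‖, ?_⟩
    rintro _ ⟨p, rfl⟩
    calc _ ≤ ‖p.π f‖ * ‖((p.u ^ n : unitary (p.H →L[ℂ] p.H)) : p.H →L[ℂ] p.H)‖ := norm_mul_le _ _
      _ ≤ ‖f‖ * 1 := by
        gcongr
        · exact NonUnitalStarAlgHom.norm_apply_le p.π f
        · exact norm_unitary_le _
      _ = ‖f‖ := mul_one _⟩

variable (X)

/-- The closed `*`-subalgebra generated by the monomials `f u ^ n` in the universal
representation. -/
def monomialAlgebra : NonUnitalStarSubalgebra ℂ (BoundedFamilies X) :=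
  (NonUnitalStarAlgebra.adjoin ℂ
    {a : BoundedFamilies X | ∃ f n, a = monomial f n}).topologicalClosure

/-- The (full) crossed product `C₀(X) ⋊ ℤ`: the C*-algebra generated by the monomials `f u ^ n` in
the universal representation. Since products and adjoints of monomials are monomials, this is the
closure of the image of the convolution algebra `C_c(ℤ, C₀(X))`, on which the norm is the universal
norm `‖∑ f_n δ_n‖ = sup ‖∑ π(f_n) u ^ n‖`, the supremum being over all covariant representations.
(Hilbert spaces in the universe of `X` suffice, as cyclic representations have such a model.) -/
def CrossedProduct : Type (u + 1) := monomialAlgebra X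

instance : NonUnitalCStarAlgebra (CrossedProduct X) :=
  NonUnitalStarSubalgebra.nonUnitalCStarAlgebra (monomialAlgebra X)
    (h_closed := NonUnitalStarSubalgebra.isClosed_topologicalClosure _)

variable {X}

theorem monomial_mem (f : C₀(X, ℂ)) (n : ℤ) : monomial f n ∈ monomialAlgebra X :=
  NonUnitalStarSubalgebra.le_topologicalClosure _
    (NonUnitalStarAlgebra.subset_adjoin ℂ _ ⟨f, n, rfl⟩)

/-- The element `f u ^ n` of the crossed product. -/
def mk (f : C₀(X, ℂ)) (n : ℤ) : CrossedProduct X := ⟨monomial f n, monomial_mem f n⟩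

theorem smul_mem_unitary {B : Type u} [CStarAlgebra B] (z : Circle) (v : unitary B) :
    (z : ℂ) • (v : B) ∈ unitary B := by
  have hz : (starRingEnd ℂ) (z : ℂ) * (z : ℂ) = 1 := by
    rw [mul_comm, Complex.mul_conj, Circle.normSq_coe, Complex.ofReal_one]
  have hz' : (z : ℂ) * (starRingEnd ℂ) (z : ℂ) = 1 := by rw [mul_comm]; exact hz
  have h1 : star (v : B) * (v : B) = 1 := Unitary.coe_star_mul_self v
  have h2 : (v : B) * star (v : B) = 1 := Unitary.coe_mul_star_self v
  rw [Unitary.mem_iff]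
  constructor
  · rw [star_smul, smul_mul_smul_comm, h1, RCLike.star_def, hz, one_smul]
  · rw [star_smul, smul_mul_smul_comm, h2, RCLike.star_def, hz', one_smul]

theorem smul_unitary_zpow {B : Type u} [CStarAlgebra B] (z : Circle) (v : unitary B) (n : ℤ) :
    (((⟨(z : ℂ) • (v : B), smul_mem_unitary z v⟩ : unitary B) ^ n : unitary B) : B) =
      ((z ^ n : Circle) : ℂ) • ((v ^ n : unitary B) : B) := by
  let c : Circle →* unitary B :=
    { toFun := fun w => ⟨(w : ℂ) • ((1 : unitary B) : B), smul_mem_unitary w 1⟩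
      map_one' := Subtype.ext (by simp)
      map_mul' := fun w w' => Subtype.ext (by simp [smul_smul, mul_comm]) }
  have hcv : Commute (c z) v := Subtype.ext (by simp [c])
  have h : (⟨(z : ℂ) • (v : B), smul_mem_unitary z v⟩ : unitary B) = c z * v :=
    Subtype.ext (by simp [c])
  rw [h, hcv.mul_zpow, ← map_zpow]
  simp [c]

/-- For `z` in the unit circle, the covariant representation `(π, z u)`. -/
def CovariantRep.twist (z : Circle) (p : CovariantRep X) : CovariantRep X where
  H := p.H
  π := p.π
  u := ⟨(z : ℂ) • (p.u : p.H →L[ℂ] p.H), smul_mem_unitary z p.u⟩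
  covariant f := by
    have hz : (starRingEnd ℂ) (z : ℂ) * (z : ℂ) = 1 := by
      rw [mul_comm, Complex.mul_conj, Circle.normSq_coe, Complex.ofReal_one]
    rw [← p.covariant f]
    simp [smul_smul, hz]

/-- Precomposition of families with `(π, u) ↦ (π, z u)`. -/
def twistHom (z : Circle) : BoundedFamilies X →⋆ₙₐ[ℂ] BoundedFamilies X where
  toFun F := ⟨fun p => F.1 (p.twist z), by
    obtain ⟨C, hC⟩ := memℓp_infty_iff.1 F.2
    refine memℓp_infty ⟨C, ?_⟩
    rintro _ ⟨p, rfl⟩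
    exact hC ⟨p.twist z, rfl⟩⟩
  map_smul' _ _ := rfl
  map_zero' := rfl
  map_add' _ _ := rfl
  map_mul' _ _ := rfl
  map_star' _ := rfl

theorem twistHom_monomial (z : Circle) (f : C₀(X, ℂ)) (n : ℤ) :
    twistHom z (monomial f n) = ((z ^ n : Circle) : ℂ) • monomial f n := by
  refine Subtype.ext (funext fun p => ?_)
  change p.π f * (((⟨(z : ℂ) • (p.u : p.H →L[ℂ] p.H), smul_mem_unitary z p.u⟩ :
      unitary (p.H →L[ℂ] p.H)) ^ n : unitary (p.H →L[ℂ] p.H)) : p.H →L[ℂ] p.H) =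
    ((z ^ n : Circle) : ℂ) • (p.π f * ((p.u ^ n : unitary (p.H →L[ℂ] p.H)) : p.H →L[ℂ] p.H))
  rw [smul_unitary_zpow, mul_smul_comm]

theorem twistHom_mem (z : Circle) {a : BoundedFamilies X} (ha : a ∈ monomialAlgebra X) :
    twistHom z a ∈ monomialAlgebra X := by
  have hc : Continuous (twistHom (X := X) z) := by
    refine AddMonoidHomClass.continuous_of_bound (twistHom (X := X) z) 1 fun F => ?_
    rw [one_mul]
    exact NonUnitalStarAlgHom.norm_apply_le (twistHom (X := X) z) F
  have hle : monomialAlgebra X ≤ (monomialAlgebra X).comap (twistHom z) := by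
    refine NonUnitalStarSubalgebra.topologicalClosure_minimal _ ?_
      ((NonUnitalStarSubalgebra.isClosed_topologicalClosure _).preimage hc)
    refine NonUnitalStarAlgebra.adjoin_le ?_
    rintro _ ⟨f, n, rfl⟩
    change twistHom z (monomial f n) ∈ monomialAlgebra X
    rw [twistHom_monomial]
    exact SMulMemClass.smul_mem _ (monomial_mem f n)
  exact hle ha

/-- The gauge action `γ` of the unit circle on `C₀(X) ⋊ ℤ`, induced by `(π, u) ↦ (π, z u)`;
it is determined by `γ_z (f u ^ n) = z ^ n f u ^ n`. -/
def gaugeAction (z : Circle) : CrossedProduct X →⋆ₙₐ[ℂ] CrossedProduct X where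
  toFun a := ⟨twistHom z a.1, twistHom_mem z a.2⟩
  map_smul' c a := Subtype.ext (map_smul (twistHom z) c a.1)
  map_zero' := Subtype.ext (map_zero (twistHom z))
  map_add' a b := Subtype.ext (map_add (twistHom z) a.1 b.1)
  map_mul' a b := Subtype.ext (map_mul (twistHom z) a.1 b.1)
  map_star' a := Subtype.ext (map_star (twistHom z) a.1)

theorem gaugeAction_mk (z : Circle) (f : C₀(X, ℂ)) (n : ℤ) :
    gaugeAction z (mk f n) = ((z ^ n : Circle) : ℂ) • mk f n :=
  Subtype.ext (twistHom_monomial z f n)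

end

/-- A tracial state on a (not necessarily unital) C*-algebra: a positive linear functional of norm
one with `τ (a b) = τ (b a)`. (Positive functionals are automatically bounded.) -/
structure IsTracialState {A : Type*} [NonUnitalCStarAlgebra A] (τ : A →L[ℂ] ℂ) : Prop where
  nonneg : ∀ a, 0 ≤ τ (star a * a)
  norm_eq_one : ‖τ‖ = 1
  tracial : ∀ a b, τ (a * b) = τ (b * a)

end CrossedProductZ

end

/-! The monomials `f u ^ n` have dense span and `γ_z` scales each by `z ^ n`, so it is enough that
`τ (f u ^ n) = 0` whenever `n ≠ 0` (`trace_mk_eq_zero`). By freeness and the Hausdorff property,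
every point has an open neighbourhood `V` disjoint from `n + V`. If `f` has compact support in `V`,
choose `e` equal to one on that support and supported in `V`. Then `e f = f`, while `f` and the
translate `n · e` have disjoint supports, so `τ (f u ^ n) = τ (e f u ^ n) = τ (f u ^ n e) = τ (f (n
· e) u ^ n) = 0`. A partition of unity extends this to compactly supported `f`, and continuity of
`τ` to all of `C₀(X)`. -/

namespace CrossedProductZ

section

open Filter Topology

variable {X : Type*} [TopologicalSpace X]

/-- A compactly supported real function, as a complex function vanishing at infinity. -/
noncomputable def ofCompactSupport (h : C(X, ℝ)) (hh : HasCompactSupport h) : C₀(X, ℂ) where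
  toFun x := (h x : ℂ)
  continuous_toFun := by fun_prop
  zero_at_infty' := (hh.comp_left (g := fun r : ℝ => (r : ℂ)) rfl).is_zero_at_infty

@[simp]
theorem ofCompactSupport_apply (h : C(X, ℝ)) (hh : HasCompactSupport h) (x : X) :
    ofCompactSupport h hh x = h x := rfl

theorem norm_le_of_forall {f : C₀(X, ℂ)} {C : ℝ} (hC : 0 ≤ C) (h : ∀ x, ‖f x‖ ≤ C) : ‖f‖ ≤ C := by
  rw [← ZeroAtInftyContinuousMap.norm_toBCF_eq_norm]
  exact (BoundedContinuousFunction.norm_le hC).2 h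

theorem sum_apply {ι : Type*} (s : Finset ι) (f : ι → C₀(X, ℂ)) (x : X) :
    (∑ i ∈ s, f i) x = ∑ i ∈ s, f i x :=
  map_sum (⟨⟨fun g : C₀(X, ℂ) => g x, rfl⟩, fun _ _ => rfl⟩ : C₀(X, ℂ) →+ ℂ) f s

/-- The cutoff is one on a compact set outside of which `‖f‖ < ε`, and takes values in `[0, 1]`
elsewhere. -/
theorem exists_compactSupport_norm_sub_mul_le [LocallyCompactSpace X] [T2Space X]
    (f : C₀(X, ℂ)) {ε : ℝ} (hε : 0 < ε) :
    ∃ (h : C(X, ℝ)) (hh : HasCompactSupport h), ‖f - f * ofCompactSupport h hh‖ ≤ ε := by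
  have hf : ∀ᶠ x in cocompact X, ‖f x‖ < ε := by
    have := (zero_at_infty f).norm
    rw [norm_zero] at this
    exact this.eventually_lt_const hε
  obtain ⟨K, hK, hKf⟩ := mem_cocompact.1 hf
  obtain ⟨h, h1, hh, -, h01⟩ :=
    exists_continuousMap_one_of_isCompact_subset_isOpen hK isOpen_univ (Set.subset_univ K)
  replace hh : HasCompactSupport h := hh
  refine ⟨h, hh, norm_le_of_forall hε.le fun x => ?_⟩
  have hx : (f - f * ofCompactSupport h hh) x = f x * ((1 - h x : ℝ) : ℂ) := by
    simp [mul_sub]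
  rw [hx, norm_mul, Complex.norm_real]
  by_cases hxK : x ∈ K
  · simp [h1 hxK, hε.le]
  · have h2 : ‖1 - h x‖ ≤ 1 := by
      rw [Real.norm_eq_abs, abs_le]
      constructor <;> linarith [(h01 x).1, (h01 x).2]
    have h3 : ‖f x‖ < ε := hKf hxK
    nlinarith [norm_nonneg (f x)]

/-! ### Displacement by the action and the algebra of monomials -/

variable [AddAction ℤ X] [ContinuousConstVAdd ℤ X]

/-- Separate `x` and `n +ᵥ x` by disjoint `W` and `U`, then shrink `W` to the points that `n` sends
into `U`. -/
theorem exists_isOpen_disjoint_vadd [T2Space X] {n : ℤ} {x : X} (hx : n +ᵥ x ≠ x) :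
    ∃ V : Set X, IsOpen V ∧ x ∈ V ∧ ∀ y ∈ V, n +ᵥ y ∉ V := by
  obtain ⟨U, W, hU, hW, hxU, hxW, hUW⟩ := t2_separation hx
  refine ⟨W ∩ (fun y => n +ᵥ y) ⁻¹' U, hW.inter (hU.preimage (continuous_const_vadd n)),
    ⟨hxW, hxU⟩, fun y hy hy' => ?_⟩
  exact Set.disjoint_left.1 hUW hy.2 hy'.1

theorem act_zero (f : C₀(X, ℂ)) : act 0 f = f := by
  ext x; simp

theorem act_act (m n : ℤ) (f : C₀(X, ℂ)) : act m (act n f) = act (m + n) f := by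
  ext x
  simp only [act_apply, vadd_vadd]
  congr 2
  ring

theorem CovariantRep.π_act_one (p : CovariantRep X) (f : C₀(X, ℂ)) :
    p.π (act 1 f) * (p.u : p.H →L[ℂ] p.H) = (p.u : p.H →L[ℂ] p.H) * p.π f := by
  rw [← p.covariant f, mul_assoc, Unitary.coe_star_mul_self, mul_one]

theorem CovariantRep.star_u_mul_π (p : CovariantRep X) (f : C₀(X, ℂ)) :
    star (p.u : p.H →L[ℂ] p.H) * p.π f = p.π (act (-1) f) * star (p.u : p.H →L[ℂ] p.H) := by
  have h := p.covariant (act (-1) f)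
  rw [act_act, add_neg_cancel, act_zero] at h
  rw [← h, ← mul_assoc, ← mul_assoc, Unitary.coe_star_mul_self, one_mul]

theorem CovariantRep.zpow_mul_π (p : CovariantRep X) (n : ℤ) (f : C₀(X, ℂ)) :
    ((p.u ^ n : unitary (p.H →L[ℂ] p.H)) : p.H →L[ℂ] p.H) * p.π f =
      p.π (act n f) * ((p.u ^ n : unitary (p.H →L[ℂ] p.H)) : p.H →L[ℂ] p.H) := by
  induction n generalizing f with
  | zero => simp [act_zero]
  | succ k ih =>
    rw [zpow_add_one, Submonoid.coe_mul, mul_assoc, ← p.π_act_one, ← mul_assoc, ih, act_act,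
      mul_assoc]
  | pred k ih =>
    rw [zpow_sub_one, ← Unitary.star_eq_inv, Submonoid.coe_mul, Unitary.coe_star, mul_assoc,
      p.star_u_mul_π, ← mul_assoc, ih, act_act, mul_assoc, sub_eq_add_neg]

theorem monomial_mul_monomial (f g : C₀(X, ℂ)) (m n : ℤ) :
    monomial f m * monomial g n = monomial (f * act m g) (m + n) := by
  refine Subtype.ext (funext fun p => ?_)
  change p.π f * _ * (p.π g * _) = p.π (f * act m g) * _
  rw [map_mul, zpow_add, Submonoid.coe_mul, mul_assoc, ← mul_assoc _ (p.π g), p.zpow_mul_π]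
  simp only [mul_assoc]

theorem star_monomial (f : C₀(X, ℂ)) (n : ℤ) :
    star (monomial f n) = monomial (act (-n) (star f)) (-n) := by
  refine Subtype.ext (funext fun p => ?_)
  change star (p.π f * ((p.u ^ n : unitary (p.H →L[ℂ] p.H)) : p.H →L[ℂ] p.H)) =
    p.π (act (-n) (star f)) * _
  rw [← p.zpow_mul_π, star_mul, zpow_neg, ← Unitary.star_eq_inv, Unitary.coe_star, map_star]

theorem mk_mul_mk (f g : C₀(X, ℂ)) (m n : ℤ) : mk f m * mk g n = mk (f * act m g) (m + n) :=
  Subtype.ext (monomial_mul_monomial f g m n)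

variable (X) in
/-- The map `f ↦ f u ^ n` as a bounded linear map. -/
noncomputable def mkCLM (n : ℤ) : C₀(X, ℂ) →L[ℂ] CrossedProduct X :=
  LinearMap.mkContinuous
    { toFun := fun f => mk f n
      map_add' := fun f g => Subtype.ext <| Subtype.ext <| funext fun p => by
        change p.π (f + g) * _ = p.π f * _ + p.π g * _
        rw [map_add, add_mul]
      map_smul' := fun c f => Subtype.ext <| Subtype.ext <| funext fun p => by
        change p.π (c • f) * _ = c • (p.π f * _)
        rw [map_smul, smul_mul_assoc] }
    1 fun f => by
      rw [one_mul]
      refine lp.norm_le_of_forall_le (norm_nonneg f) fun p => ?_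
      calc ‖p.π f * ((p.u ^ n : unitary (p.H →L[ℂ] p.H)) : p.H →L[ℂ] p.H)‖
          ≤ ‖p.π f‖ * ‖((p.u ^ n : unitary (p.H →L[ℂ] p.H)) : p.H →L[ℂ] p.H)‖ := norm_mul_le _ _
        _ ≤ ‖f‖ * 1 := by
          gcongr
          · exact NonUnitalStarAlgHom.norm_apply_le p.π f
          · exact norm_unitary_le _
        _ = ‖f‖ := mul_one _

@[simp]
theorem mkCLM_apply (n : ℤ) (f : C₀(X, ℂ)) : mkCLM X n f = mk f n := rfl

/-! ### Vanishing of traces on monomials with `n ≠ 0` -/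

variable {τ : CrossedProduct X →L[ℂ] ℂ}

/-- The trace moves `e` from the left, where it fixes `f u ^ n`, to the right, where commuting past
`u ^ n` turns it into `act n e`, which annihilates `f`. -/
theorem trace_mk_eq_zero_of_mul_act_eq_zero (hτ : ∀ a b, τ (a * b) = τ (b * a)) {n : ℤ}
    {e f : C₀(X, ℂ)} (hef : e * f = f) (hfe : f * act n e = 0) : τ (mk f n) = 0 := by
  have h1 : mk e 0 * mk f n = mk f n := by rw [mk_mul_mk, act_zero, hef, zero_add]
  have h2 : mk f n * mk e 0 = 0 := by rw [mk_mul_mk, hfe]; exact map_zero (mkCLM X _)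
  rw [← h1, hτ, h2, map_zero]

variable [LocallyCompactSpace X] [T2Space X]

theorem trace_mk_mul_eq_zero (hτ : ∀ a b, τ (a * b) = τ (b * a)) {n : ℤ} {V : Set X}
    (hV : IsOpen V) (hnV : ∀ y ∈ V, n +ᵥ y ∉ V) (f : C₀(X, ℂ)) (h : C(X, ℝ))
    (hh : HasCompactSupport h) (hhV : tsupport h ⊆ V) :
    τ (mk (f * ofCompactSupport h hh) n) = 0 := by
  obtain ⟨e, he1, he, heV, -⟩ := exists_continuousMap_one_of_isCompact_subset_isOpen hh hV hhV
  replace he : HasCompactSupport e := he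
  refine trace_mk_eq_zero_of_mul_act_eq_zero hτ (e := ofCompactSupport e he) ?_ ?_
  · ext x
    by_cases hx : x ∈ tsupport h
    · simp [he1 hx]
    · simp [image_eq_zero_of_notMem_tsupport hx]
  · ext x
    by_cases hx : x ∈ tsupport h
    · have hx' : (-n) +ᵥ x ∉ tsupport e := fun hx' => by
        have := hnV _ (heV hx')
        rw [vadd_neg_vadd] at this
        exact this (hhV hx)
      simp [image_eq_zero_of_notMem_tsupport hx']
    · simp [image_eq_zero_of_notMem_tsupport hx]

theorem trace_mk_mul_ofCompactSupport_eq_zero (hτ : ∀ a b, τ (a * b) = τ (b * a)) {n : ℤ}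
    (hn : ∀ x : X, n +ᵥ x ≠ x) (f : C₀(X, ℂ)) (h : C(X, ℝ)) (hh : HasCompactSupport h) :
    τ (mk (f * ofCompactSupport h hh) n) = 0 := by
  choose V hV hxV hnV using fun x => exists_isOpen_disjoint_vadd (hn x)
  obtain ⟨t, ht⟩ := IsCompact.elim_finite_subcover (s := tsupport h) hh V hV
    fun x _ => Set.mem_iUnion.2 ⟨x, hxV x⟩
  -- The partition of unity is indexed by `Fin`, hence the reindexing of the cover. It sums to one
  -- only on `tsupport h`, which suffices because `h` vanishes elsewhere.
  obtain ⟨g, hgV, hg1, -, hg⟩ := exists_continuous_sum_one_of_isOpen_isCompact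
    (s := fun i => V (t.equivFin.symm i)) (fun i => hV _) (t := tsupport h) hh fun x hx => by
      obtain ⟨y, hy, hxy⟩ := Set.mem_iUnion₂.1 (ht hx)
      exact Set.mem_iUnion.2 ⟨t.equivFin ⟨y, hy⟩, by simpa using hxy⟩
  have hsum : f * ofCompactSupport h hh =
      ∑ i, f * ofCompactSupport h hh * ofCompactSupport (g i) (hg i) := by
    rw [← Finset.mul_sum]
    ext x
    have hs : (∑ i, ofCompactSupport (g i) (hg i)) x = ((∑ i, g i x : ℝ) : ℂ) := by
      rw [sum_apply, Complex.ofReal_sum]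
      rfl
    rw [ZeroAtInftyContinuousMap.mul_apply, ZeroAtInftyContinuousMap.mul_apply, hs]
    by_cases hx : x ∈ tsupport h
    · have := hg1 hx
      simp only [Finset.sum_apply, Pi.one_apply] at this
      simp [this]
    · simp [image_eq_zero_of_notMem_tsupport hx]
  rw [hsum, ← mkCLM_apply, map_sum, map_sum]
  exact Finset.sum_eq_zero fun i _ => trace_mk_mul_eq_zero hτ (hV _) (hnV _) _ _ (hg i) (hgV i)

theorem trace_mk_eq_zero (hτ : ∀ a b, τ (a * b) = τ (b * a)) {n : ℤ}
    (hn : ∀ x : X, n +ᵥ x ≠ x) (f : C₀(X, ℂ)) : τ (mk f n) = 0 := by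
  set L : C₀(X, ℂ) →L[ℂ] ℂ := τ ∘L mkCLM X n with hL
  have hcl : IsClosed {g : C₀(X, ℂ) | L g = 0} := isClosed_eq L.continuous continuous_const
  change f ∈ {g : C₀(X, ℂ) | L g = 0}
  rw [← hcl.closure_eq, Metric.mem_closure_iff]
  intro ε hε
  -- Half of `ε`, since the cutoff bound is not strict and the closure criterion is.
  obtain ⟨h, hh, hle⟩ := exists_compactSupport_norm_sub_mul_le f (half_pos hε)
  exact ⟨f * ofCompactSupport h hh, trace_mk_mul_ofCompactSupport_eq_zero hτ hn f h hh, by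
    rw [dist_eq_norm]; linarith⟩

end

/-! ### Density of the span of monomials -/

section

variable {X : Type*} [TopologicalSpace X] [AddAction ℤ X] [ContinuousConstVAdd ℤ X]

/-- Products and adjoints of monomials are monomials, so their linear span is already a
`*`-subalgebra. -/
theorem adjoin_monomial_le_span {a : BoundedFamilies X}
    (ha : a ∈ NonUnitalStarAlgebra.adjoin ℂ {a : BoundedFamilies X | ∃ f n, a = monomial f n}) :
    a ∈ Submodule.span ℂ {a : BoundedFamilies X | ∃ f n, a = monomial f n} := by
  set S := {a : BoundedFamilies X | ∃ f n, a = monomial f n} with hS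
  induction ha using NonUnitalStarAlgebra.adjoin_induction with
  | mem x hx => exact Submodule.subset_span hx
  | add x y _ _ hx hy => exact add_mem hx hy
  | zero => exact zero_mem _
  | smul r x _ hx => exact Submodule.smul_mem _ r hx
  | mul x y _ _ hx hy =>
    refine Submodule.span_induction₂ (p := fun x y _ _ => x * y ∈ Submodule.span ℂ S)
      ?_ ?_ ?_ ?_ ?_ ?_ ?_ hx hy
    · rintro _ _ ⟨f, m, rfl⟩ ⟨g, n, rfl⟩
      exact Submodule.subset_span ⟨_, _, monomial_mul_monomial f g m n⟩
    · intro y _; rw [zero_mul]; exact zero_mem _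
    · intro y _; rw [mul_zero]; exact zero_mem _
    · intro x y z _ _ _ h1 h2; rw [add_mul]; exact add_mem h1 h2
    · intro x y z _ _ _ h1 h2; rw [mul_add]; exact add_mem h1 h2
    · intro r x y _ _ h; rw [smul_mul_assoc]; exact Submodule.smul_mem _ r h
    · intro r x y _ _ h; rw [mul_smul_comm]; exact Submodule.smul_mem _ r h
  | star x _ hx =>
    refine Submodule.span_induction (p := fun x _ => star x ∈ Submodule.span ℂ S) ?_ ?_ ?_ ?_ hx
    · rintro _ ⟨f, n, rfl⟩
      exact Submodule.subset_span ⟨_, _, star_monomial f n⟩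
    · rw [star_zero]; exact zero_mem _
    · intro x y _ _ h1 h2; rw [star_add]; exact add_mem h1 h2
    · intro r x _ h; rw [star_smul]; exact Submodule.smul_mem _ _ h

theorem dense_span_mk :
    Dense (Submodule.span ℂ {a : CrossedProduct X | ∃ f n, a = mk f n} : Set (CrossedProduct X)) := by
  -- Approximants are found in `BoundedFamilies X`; this lifts them to the span inside the crossed
  -- product, whose norm is the restricted one.
  have hmap : ∀ b ∈ Submodule.span ℂ {a : BoundedFamilies X | ∃ f n, a = monomial f n},
      ∃ c ∈ Submodule.span ℂ {a : CrossedProduct X | ∃ f n, a = mk f n}, c.1 = b := by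
    intro b hb
    induction hb using Submodule.span_induction with
    | mem x hx =>
      obtain ⟨f, n, rfl⟩ := hx
      exact ⟨mk f n, Submodule.subset_span ⟨f, n, rfl⟩, rfl⟩
    | zero => exact ⟨0, zero_mem _, rfl⟩
    | add x y _ _ hx hy =>
      obtain ⟨c, hc, rfl⟩ := hx
      obtain ⟨d, hd, rfl⟩ := hy
      exact ⟨c + d, add_mem hc hd, rfl⟩
    | smul r x _ hx =>
      obtain ⟨c, hc, rfl⟩ := hx
      exact ⟨r • c, Submodule.smul_mem _ r hc, rfl⟩
  intro a
  rw [Metric.mem_closure_iff]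
  intro ε hε
  obtain ⟨b, hb, hab⟩ := Metric.mem_closure_iff.1
    (show a.1 ∈ closure (NonUnitalStarAlgebra.adjoin ℂ
      {a : BoundedFamilies X | ∃ f n, a = monomial f n} : Set (BoundedFamilies X)) from a.2) ε hε
  obtain ⟨c, hc, rfl⟩ := hmap b (adjoin_monomial_le_span hb)
  exact ⟨c, hc, hab⟩

theorem continuous_gaugeAction (z : Circle) : Continuous (gaugeAction (X := X) z) :=
  AddMonoidHomClass.continuous_of_bound (gaugeAction (X := X) z) 1 fun a => by
    rw [one_mul]
    exact NonUnitalStarAlgHom.norm_apply_le (gaugeAction (X := X) z) a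

end

end CrossedProductZ

theorem mainTheorem9 {X : Type*} [TopologicalSpace X] [LocallyCompactSpace X] [T2Space X]
    [AddAction ℤ X] [ContinuousConstVAdd ℤ X]
    (hfree : ∀ (n : ℤ) (x : X), n +ᵥ x = x → n = 0)
    (τ : CrossedProductZ.CrossedProduct X →L[ℂ] ℂ)
    (hτ : CrossedProductZ.IsTracialState τ) :
    ∀ (z : Circle) (a : CrossedProductZ.CrossedProduct X),
      τ (CrossedProductZ.gaugeAction z a) = τ a := by
  intro z
  refine fun a => congrFun (Continuous.ext_on CrossedProductZ.dense_span_mk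
    (τ.continuous.comp (CrossedProductZ.continuous_gaugeAction z)) τ.continuous ?_) a
  intro a ha
  change τ (CrossedProductZ.gaugeAction z a) = τ a
  induction ha using Submodule.span_induction with
  | mem x hx =>
    obtain ⟨f, n, rfl⟩ := hx
    rw [CrossedProductZ.gaugeAction_mk, map_smul]
    -- For `n = 0` the gauge factor is one; otherwise both sides vanish.
    rcases eq_or_ne n 0 with rfl | hn
    · simp
    · rw [CrossedProductZ.trace_mk_eq_zero hτ.tracial (fun x hx => hn (hfree n x hx)), smul_zero]
  | zero => simp
  | add x y _ _ hx hy => rw [map_add, map_add, map_add, hx, hy]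
  | smul r x _ hx => rw [map_smul, map_smul, map_smul, hx]
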